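/- Let $m,n,q\ge 1$, let $\mathbb{T}=\mathbb{R}\cup\{-\infty\}$ be the max-plus semifield, let $A\in\mathbb{T}^{m\times n}$ have at least one finite entry in every column and in every row, let $B\in\mathbb{T}^{m\times q}$ have at least one finite entry in every row, and let $P\in\mathbb{R}^{q\times n}$ be row-stochastic. Define $F\colon\mathbb{T}^n\to\mathbb{T}^n$ and $F^*\colon\mathbb{T}^m\to\mathbb{T}^m$ by $$F=A^\sharp\circ B\circ P,\qquad F^*=(B^\top)^\sharp\circ P\circ A^\top ,$$ where, for $M\in\{B,A^\top\}$, $(M\odot x)_i=\max_j (M_{ij}+x_j)$ is the max-plus product; $P$ acts by the usual product $(Px)_k=\sum_l P_{kl}x_l$ (with $0\cdot(-\infty)=0$); and, for a matrix $M$ over $\mathbb{T}$, $(M^\sharp(y))_j=\min_i(-M_{ij}+y_i)$ with $(+\infty)+(-\infty)=+\infty$. For a map $G\colon\mathbb{T}^k\to\mathbb{T}^k$, say that $\mathscr{P}(G)$ is feasible if there is $x\in\mathbb{T}^k$, not identically $-\infty$, with $x\le G(x)$ entrywise, and that $\mathscr{P}_{\mathbb{R}}(G)$ is feasible if there is $x\in\mathbb{R}^k$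 with $x_i<G_i(x)$ for all $i$. For $\mathscr{Q}\in\{\mathscr{P},\mathscr{P}_{\mathbb{R}}\}$, the condition number of $\mathscr{Q}(G)$ is the element of $[0,+\infty]$ given by $$\bigl(\inf\{\|u\|_\infty : u\in\mathbb{R}^k,\ \mathscr{Q}(u+G)\text{ is infeasible}\}\bigr)^{-1}\quad\text{if }\mathscr{Q}(G)\text{ is feasible},$$ $$\bigl(\inf\{\|u\|_\infty : u\in\mathbb{R}^k,\ \mathscr{Q}(u+G)\text{ is feasible}\}\bigr)^{-1}\quad\text{if }\mathscr{Q}(G)\text{ is infeasible},$$ where $0^{-1}=+\infty$ and $(u+G)(x)=u+G(x)$. Then: 1. the condition number of $\mathscr{P}_{\mathbb{R}}(F)$ equals the condition number of $\mathscr{P}(F^*)$; 2. either $\mathscr{P}(F^*)$ is feasible or $\mathscr{P}_{\mathbb{R}}(F)$ is feasible, and they are not both feasible; 3. $\mathscr{P}_{\mathbb{R}}(F)$ and $\mathscr{P}_{\mathbb{R}}(F^*)$ are not both feasible. -/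

import Mathlib

open scoped ENNReal Matrix

noncomputable section

namespace MeanPayoff

/-- The max-plus semifield `ℝ ∪ {-∞}`: the tropical addition is `max`, the tropical
multiplication is `+` (with `-∞` absorbing), and `⊥` stands for `-∞`. -/
abbrev MaxPlus : Type := WithBot ℝ

/-- The inclusion of `ℝ ∪ {-∞}` into `ℝ ∪ {-∞, +∞}`. -/
def MaxPlus.toEReal : MaxPlus → EReal
  | ⊥ => ⊥
  | (r : ℝ) => (r : EReal)

/-- The left inverse of `MaxPlus.toEReal`. (The value at `+∞` is irrelevant.) -/
def MaxPlus.ofEReal (a : EReal) : MaxPlus :=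
  open Classical in if a = ⊥ then ⊥ else ((a.toReal : ℝ) : MaxPlus)

/-- A real vector seen as a vector with entries in `ℝ ∪ {-∞}`. -/
def realVec {n : ℕ} (x : Fin n → ℝ) : Fin n → MaxPlus := fun j => (x j : MaxPlus)

/-- The max-plus matrix-vector product `A ⊙ x`. -/
def maxPlusMulVec {m n : ℕ} (A : Matrix (Fin m) (Fin n) MaxPlus) (x : Fin n → MaxPlus) :
    Fin m → MaxPlus :=
  fun i => Finset.univ.sup fun j => A i j + x j

/-- Multiplication of the completed min-plus semiring `ℝ ∪ {-∞, +∞}`: the usual sum, with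
`(-∞) + (+∞) = (+∞) + (-∞) = +∞`. (The addition of `EReal` takes the value `-∞` there.) -/
def minPlusAdd (a b : EReal) : EReal :=
  open Classical in if a = ⊤ ∨ b = ⊤ then ⊤ else a + b

/-- The matrix-vector product `M ⊙' y` over the completed min-plus semiring. -/
def minPlusMulVec {n m : ℕ} (M : Matrix (Fin n) (Fin m) EReal) (y : Fin m → EReal) :
    Fin n → EReal :=
  fun j => ⨅ i, minPlusAdd (M j i) (y i)

/-- The adjoint `A♯ (y) = (-Aᵀ) ⊙' y` of a max-plus matrix `A`. -/
def adjoint {m n : ℕ} (A : Matrix (Fin m) (Fin n) MaxPlus) (y : Fin m → EReal) :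
    Fin n → EReal :=
  minPlusMulVec (Matrix.of fun j i => -(A i j).toEReal) y

/-- The adjoint `A♯` as a map from `(ℝ ∪ {-∞})^m` to `(ℝ ∪ {-∞})^n`; it takes its values there as
soon as every column of `A` has a finite entry, see `toEReal_adjointTrop`. -/
def adjointTrop {m n : ℕ} (A : Matrix (Fin m) (Fin n) MaxPlus) (y : Fin m → MaxPlus) :
    Fin n → MaxPlus :=
  fun j => MaxPlus.ofEReal (adjoint A (fun i => (y i).toEReal) j)

/-- The usual product `P x` of a nonnegative real matrix and a vector of `(ℝ ∪ {-∞})^n`,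
with `0 * (-∞) = 0` and `p * (-∞) = -∞` for `p > 0`. -/
def stochMulVec {q n : ℕ} (P : Matrix (Fin q) (Fin n) ℝ) (x : Fin n → MaxPlus) :
    Fin q → MaxPlus :=
  fun k => ∑ l, (P k l : MaxPlus) * x l

/-- The Shapley operator `F = A♯ ∘ B ∘ P`. -/
def shapley {m n q : ℕ} (A : Matrix (Fin m) (Fin n) MaxPlus)
    (B : Matrix (Fin m) (Fin q) MaxPlus) (P : Matrix (Fin q) (Fin n) ℝ) :
    (Fin n → MaxPlus) → (Fin n → MaxPlus) :=
  adjointTrop A ∘ maxPlusMulVec B ∘ stochMulVec P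

/-- The Shapley operator `F* = (Bᵀ)♯ ∘ P ∘ Aᵀ` of the dual game. -/
def dualShapley {m n q : ℕ} (A : Matrix (Fin m) (Fin n) MaxPlus)
    (B : Matrix (Fin m) (Fin q) MaxPlus) (P : Matrix (Fin q) (Fin n) ℝ) :
    (Fin m → MaxPlus) → (Fin m → MaxPlus) :=
  adjointTrop Bᵀ ∘ stochMulVec P ∘ maxPlusMulVec Aᵀ

/-- Every row of `P` is a probability vector. -/
def IsRowStochastic {q n : ℕ} (P : Matrix (Fin q) (Fin n) ℝ) : Prop :=
  (∀ k l, 0 ≤ P k l) ∧ ∀ k, ∑ l, P k l = 1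

/-- Every row of `A` has at least one finite entry. -/
def RowFinite {m n : ℕ} (A : Matrix (Fin m) (Fin n) MaxPlus) : Prop :=
  ∀ i, ∃ j, A i j ≠ ⊥

/-- Every column of `A` has at least one finite entry. -/
def ColFinite {m n : ℕ} (A : Matrix (Fin m) (Fin n) MaxPlus) : Prop :=
  ∀ j, ∃ i, A i j ≠ ⊥

/-- Feasibility of `𝒫(F)`: there is `x ∈ (ℝ ∪ {-∞})^n`, not identically `-∞`,
such that `x ≤ F(x)`. -/
def Feasible {n : ℕ} (F : (Fin n → MaxPlus) → (Fin n → MaxPlus)) : Prop :=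
  ∃ x : Fin n → MaxPlus, x ≠ (fun _ => ⊥) ∧ x ≤ F x

/-- Feasibility of `𝒫_ℝ(F)`: there is `x ∈ ℝ^n` such that `x_i < F_i(x)` for all `i`. -/
def StrictFeasible {n : ℕ} (F : (Fin n → MaxPlus) → (Fin n → MaxPlus)) : Prop :=
  ∃ x : Fin n → ℝ, ∀ i, (x i : MaxPlus) < F (realVec x) i

/-- The perturbed map `u + F : x ↦ u + F(x)`. -/
def perturb {n : ℕ} (u : Fin n → ℝ) (F : (Fin n → MaxPlus) → (Fin n → MaxPlus)) :
    (Fin n → MaxPlus) → (Fin n → MaxPlus) :=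
  fun x => realVec u + F x

/-- The condition number of a feasibility problem `Q` at `F`: the inverse (with `0⁻¹ = +∞`) of the
infimum of the sup-norms of the `u ∈ ℝ^n` such that `Q(u + F)` is infeasible if `Q(F)` is
feasible, and such that `Q(u + F)` is feasible if `Q(F)` is infeasible.
(The norm of `Fin n → ℝ` is the sup-norm.) -/
def condNumber {n : ℕ} (Q : ((Fin n → MaxPlus) → (Fin n → MaxPlus)) → Prop)
    (F : (Fin n → MaxPlus) → (Fin n → MaxPlus)) : ℝ≥0∞ :=
  open Classical in
  if Q F then (⨅ (u : Fin n → ℝ) (_ : ¬ Q (perturb u F)), ENNReal.ofReal ‖u‖)⁻¹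
  else (⨅ (u : Fin n → ℝ) (_ : Q (perturb u F)), ENNReal.ofReal ‖u‖)⁻¹

/-- The condition number of `𝒫(F)`. -/
def cond {n : ℕ} (F : (Fin n → MaxPlus) → (Fin n → MaxPlus)) : ℝ≥0∞ :=
  condNumber Feasible F

/-- The condition number of `𝒫_ℝ(F)`. -/
def condReal {n : ℕ} (F : (Fin n → MaxPlus) → (Fin n → MaxPlus)) : ℝ≥0∞ :=
  condNumber StrictFeasible F

theorem MaxPlus.toEReal_ne_top (a : MaxPlus) : a.toEReal ≠ ⊤ := by
  induction a using WithBot.recBotCoe with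
  | bot => exact bot_ne_top
  | coe r => exact EReal.coe_ne_top r

theorem MaxPlus.toEReal_ofEReal {a : EReal} (h : a ≠ ⊤) : (MaxPlus.ofEReal a).toEReal = a := by
  unfold MaxPlus.ofEReal
  split_ifs with hb
  · rw [hb]; rfl
  · exact EReal.coe_toReal h hb

/-- If every column of `A` has a finite entry, then `adjointTrop A` is the restriction of the
adjoint `A♯`. -/
theorem toEReal_adjointTrop {m n : ℕ} {A : Matrix (Fin m) (Fin n) MaxPlus} (hA : ColFinite A)
    (y : Fin m → MaxPlus) (j : Fin n) :
    (adjointTrop A y j).toEReal = adjoint A (fun i => (y i).toEReal) j := by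
  refine MaxPlus.toEReal_ofEReal ?_
  obtain ⟨i, hi⟩ := hA j
  obtain ⟨r, hr⟩ := WithBot.ne_bot_iff_exists.mp hi
  refine ne_of_lt (lt_of_le_of_lt (iInf_le _ i) ?_)
  have h1 : -(A i j).toEReal = ((-r : ℝ) : EReal) := by rw [← hr]; rfl
  have h2 := (y i).toEReal_ne_top
  simp only [Matrix.of_apply, minPlusAdd, h1, h2, EReal.coe_ne_top, or_self, if_false]
  exact EReal.add_lt_top (EReal.coe_ne_top _) h2

end MeanPayoff

end

namespace MeanPayoff

open Filter Topology

/-! Everything follows from one alternative, `strictFeasible_iff_not_feasible_dual`: `𝒫_ℝ(F)` is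
feasible exactly when `𝒫(F*)` is not.

Exclusion: given `y ≤ F*(y)` and a strict real `x`, put `b = B(Px)` and look at a row maximizing `y
i + b i`; averaging by `P` contradicts `y ≤ F*(y)` there.

Existence: without a strict `x`, the discounted equations `v = F(αv)` yield real `x ≥ 0` with a zero
entry and `F(x) ≤ α⁻¹x`. As `α → 1`, fix a policy `σ` attaining the minimum in `A♯` and pass to
limits in `[0, +∞]`. The coordinates with finite limit are closed under the moves of the game, and
the limit there, with its sign reversed, gives a feasible point of `F*` (`feasible_dual_of_policy`).

Condition numbers: by monotonicity only constant perturbations matter, and shifting `B` by `c`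
shifts `F` by `c` and `F*` by `-c`. Item 3 holds because strict feasibility of `F*` implies its
feasibility. -/

theorem MaxPlus.toEReal_le_toEReal {a b : MaxPlus} : a.toEReal ≤ b.toEReal ↔ a ≤ b := by
  induction a using WithBot.recBotCoe with
  | bot => simp [MaxPlus.toEReal]
  | coe a =>
    induction b using WithBot.recBotCoe with
    | bot => simp [MaxPlus.toEReal]
    | coe b => simp [MaxPlus.toEReal]

/-- The convention `(+∞) + (-∞) = +∞` is what makes this hold for `a = ⊥`: both sides are then true.
-/
theorem le_minPlusAdd_neg_iff {a z y : MaxPlus} :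
    z.toEReal ≤ minPlusAdd (-a.toEReal) y.toEReal ↔ a + z ≤ y := by
  induction a using WithBot.recBotCoe with
  | bot => simp [MaxPlus.toEReal, minPlusAdd]
  | coe a =>
    have h1 : (-(MaxPlus.toEReal (a : MaxPlus))) = ((-a : ℝ) : EReal) := rfl
    have h2 := y.toEReal_ne_top
    simp only [minPlusAdd, h1, h2, EReal.coe_ne_top, or_self, if_false]
    induction y using WithBot.recBotCoe with
    | bot =>
      induction z using WithBot.recBotCoe with
      | bot => simp [MaxPlus.toEReal]
      | coe z => simp [MaxPlus.toEReal, ← WithBot.coe_add]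
    | coe y =>
      induction z using WithBot.recBotCoe with
      | bot => simp [MaxPlus.toEReal]
      | coe z =>
        simp only [MaxPlus.toEReal, ← WithBot.coe_add, WithBot.coe_le_coe, ← EReal.coe_add,
          EReal.coe_le_coe_iff]
        constructor <;> intro h <;> linarith

/-! ### Residuation, and monotonicity and homogeneity of the three factors. -/

section Adjoint

variable {m n q : ℕ}

/-- The residuation property of the adjoint. -/
theorem le_adjointTrop_iff {A : Matrix (Fin m) (Fin n) MaxPlus} (hA : ColFinite A)
    {y : Fin m → MaxPlus} {j : Fin n} {z : MaxPlus} :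
    z ≤ adjointTrop A y j ↔ ∀ i, A i j + z ≤ y i := by
  rw [← MaxPlus.toEReal_le_toEReal, toEReal_adjointTrop hA]
  simp only [adjoint, minPlusMulVec, le_iInf_iff, Matrix.of_apply, le_minPlusAdd_neg_iff]

/-- The finite minimum defining the adjoint is attained, and at a finite entry since its value is
not `+∞`. This provides the policy `σ`. -/
theorem exists_le_add_adjointTrop {A : Matrix (Fin m) (Fin n) MaxPlus} (hA : ColFinite A)
    (y : Fin m → MaxPlus) (j : Fin n) :
    ∃ i, A i j ≠ ⊥ ∧ y i ≤ A i j + adjointTrop A y j := by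
  obtain ⟨i₀, -⟩ := hA j
  have : Nonempty (Fin m) := ⟨i₀⟩
  obtain ⟨i, hi⟩ := exists_eq_ciInf_of_finite
    (f := fun i => minPlusAdd (-(A i j).toEReal) (y i).toEReal)
  have h : (adjointTrop A y j).toEReal = minPlusAdd (-(A i j).toEReal) (y i).toEReal := by
    rw [toEReal_adjointTrop hA, hi]; rfl
  have hAi : A i j ≠ ⊥ := by
    intro hb
    apply (adjointTrop A y j).toEReal_ne_top
    rw [h, hb]
    simp [MaxPlus.toEReal, minPlusAdd]
  refine ⟨i, hAi, ?_⟩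
  obtain ⟨a, ha⟩ := WithBot.ne_bot_iff_exists.mp hAi
  rw [← ha] at h ⊢
  have key : (((-a : ℝ) : MaxPlus) + y i) ≤ adjointTrop A y j := by
    rw [← MaxPlus.toEReal_le_toEReal, h]
    rw [le_minPlusAdd_neg_iff, ← add_assoc, ← WithBot.coe_add]
    simp
  calc y i = (a : MaxPlus) + (((-a : ℝ) : MaxPlus) + y i) := by
        rw [← add_assoc, ← WithBot.coe_add]; simp
    _ ≤ _ := by gcongr

theorem coe_add_le_iff {c : ℝ} {a b : MaxPlus} :
    (c : MaxPlus) + a ≤ b ↔ a ≤ ((-c : ℝ) : MaxPlus) + b := by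
  constructor <;> intro h
  · calc a = ((-c : ℝ) : MaxPlus) + ((c : MaxPlus) + a) := by
          rw [← add_assoc, ← WithBot.coe_add]; simp
      _ ≤ _ := by gcongr
  · calc (c : MaxPlus) + a ≤ (c : MaxPlus) + (((-c : ℝ) : MaxPlus) + b) := by gcongr
      _ = b := by rw [← add_assoc, ← WithBot.coe_add]; simp

theorem le_coe_add_iff {c : ℝ} {a b : MaxPlus} :
    a ≤ (c : MaxPlus) + b ↔ ((-c : ℝ) : MaxPlus) + a ≤ b := by
  rw [coe_add_le_iff, neg_neg]

theorem adjointTrop_mono {A : Matrix (Fin m) (Fin n) MaxPlus} (hA : ColFinite A) :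
    Monotone (adjointTrop A) := by
  intro y y' h j
  rw [le_adjointTrop_iff hA]
  exact fun i => ((le_adjointTrop_iff hA).mp le_rfl i).trans (h i)

theorem adjointTrop_coe_add {A : Matrix (Fin m) (Fin n) MaxPlus} (hA : ColFinite A) (c : ℝ)
    (y : Fin m → MaxPlus) (j : Fin n) :
    adjointTrop A (fun i => (c : MaxPlus) + y i) j = (c : MaxPlus) + adjointTrop A y j := by
  refine eq_of_forall_le_iff fun z => ?_
  rw [le_coe_add_iff, le_adjointTrop_iff hA, le_adjointTrop_iff hA]
  refine forall_congr' fun i => ?_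
  rw [le_coe_add_iff, add_left_comm]

theorem adjointTrop_shift {A A' : Matrix (Fin m) (Fin n) MaxPlus} (hA : ColFinite A)
    (hA' : ColFinite A') (c : ℝ) (h : ∀ i j, A' i j = ((-c : ℝ) : MaxPlus) + A i j)
    (y : Fin m → MaxPlus) (j : Fin n) :
    adjointTrop A' y j = (c : MaxPlus) + adjointTrop A y j := by
  refine eq_of_forall_le_iff fun z => ?_
  rw [le_coe_add_iff, le_adjointTrop_iff hA, le_adjointTrop_iff hA']
  refine forall_congr' fun i => ?_
  rw [h, add_right_comm, add_comm]

theorem le_maxPlusMulVec (A : Matrix (Fin m) (Fin n) MaxPlus) (x : Fin n → MaxPlus) (i : Fin m)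
    (j : Fin n) : A i j + x j ≤ maxPlusMulVec A x i :=
  Finset.le_sup (f := fun j => A i j + x j) (Finset.mem_univ j)

theorem maxPlusMulVec_mono (A : Matrix (Fin m) (Fin n) MaxPlus) : Monotone (maxPlusMulVec A) := by
  intro x y h i
  refine Finset.sup_mono_fun fun j _ => ?_
  gcongr
  exact h j

theorem maxPlusMulVec_coe_add (A : Matrix (Fin m) (Fin n) MaxPlus) (c : ℝ) (x : Fin n → MaxPlus)
    (i : Fin m) :
    maxPlusMulVec A (fun j => (c : MaxPlus) + x j) i = (c : MaxPlus) + maxPlusMulVec A x i := by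
  refine eq_of_forall_ge_iff fun z => ?_
  rw [coe_add_le_iff]
  simp only [maxPlusMulVec, Finset.sup_le_iff, Finset.mem_univ, true_imp_iff]
  refine forall_congr' fun j => ?_
  rw [← coe_add_le_iff, add_left_comm]

theorem maxPlusMulVec_shift {A A' : Matrix (Fin m) (Fin n) MaxPlus} (c : ℝ)
    (h : ∀ i j, A' i j = (c : MaxPlus) + A i j) (x : Fin n → MaxPlus) (i : Fin m) :
    maxPlusMulVec A' x i = (c : MaxPlus) + maxPlusMulVec A x i := by
  rw [← maxPlusMulVec_coe_add]
  simp only [maxPlusMulVec, h]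
  refine Finset.sup_congr rfl fun j _ => ?_
  rw [add_left_comm, add_assoc]

theorem coe_mul_le_coe_mul {p : ℝ} (hp : 0 ≤ p) {a b : MaxPlus} (h : a ≤ b) :
    (p : MaxPlus) * a ≤ (p : MaxPlus) * b := by
  rcases hp.eq_or_lt with rfl | hp
  · simp
  induction a using WithBot.recBotCoe with
  | bot =>
    rw [WithBot.mul_bot (by exact_mod_cast hp.ne')]
    exact bot_le
  | coe a =>
    induction b using WithBot.recBotCoe with
    | bot => simp at h
    | coe b =>
      rw [← WithBot.coe_mul, ← WithBot.coe_mul, WithBot.coe_le_coe]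
      exact mul_le_mul_of_nonneg_left (WithBot.coe_le_coe.mp h) hp.le

theorem stochMulVec_mono {P : Matrix (Fin q) (Fin n) ℝ} (hP : IsRowStochastic P) :
    Monotone (stochMulVec P) := by
  intro x y h k
  exact Finset.sum_le_sum fun l _ => coe_mul_le_coe_mul (hP.1 k l) (h l)

theorem coe_finset_sum {ι : Type*} (s : Finset ι) (f : ι → ℝ) :
    ((∑ l ∈ s, f l : ℝ) : MaxPlus) = ∑ l ∈ s, (f l : MaxPlus) := by
  classical
  induction s using Finset.induction_on with
  | empty => simp
  | insert a s ha ih => rw [Finset.sum_insert ha, Finset.sum_insert ha, WithBot.coe_add, ih]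

theorem stochMulVec_realVec (P : Matrix (Fin q) (Fin n) ℝ) (x : Fin n → ℝ) :
    stochMulVec P (realVec x) = realVec fun k => ∑ l, P k l * x l := by
  funext k
  simp [stochMulVec, realVec]

theorem stochMulVec_lt {P : Matrix (Fin q) (Fin n) ℝ} (hP : IsRowStochastic P)
    {z : Fin n → MaxPlus} {r : Fin n → ℝ} (h : ∀ l, z l < (r l : MaxPlus)) (k : Fin q) :
    stochMulVec P z k < ((∑ l, P k l * r l : ℝ) : MaxPlus) := by
  -- Entries equal to `⊥` are raised to reals, so that strictness reduces to a real weighted sum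
  -- with some positive weight.
  have : ∀ l, ∃ s : ℝ, z l ≤ (s : MaxPlus) ∧ s < r l := by
    intro l
    have hl := h l
    induction hz : z l using WithBot.recBotCoe with
    | bot => exact ⟨r l - 1, bot_le, by linarith⟩
    | coe s => exact ⟨s, le_rfl, by rw [hz] at hl; exact_mod_cast hl⟩
  choose s hs hsr using this
  refine (stochMulVec_mono hP (show z ≤ realVec s from hs) k).trans_lt ?_
  rw [stochMulVec_realVec]
  refine WithBot.coe_lt_coe.mpr ?_
  obtain ⟨l, hl⟩ : ∃ l, 0 < P k l := by
    by_contra! hc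
    have := hP.2 k
    rw [Finset.sum_eq_zero fun l _ => le_antisymm (hc l) (hP.1 k l)] at this
    exact zero_ne_one this
  exact Finset.sum_lt_sum (fun l _ => mul_le_mul_of_nonneg_left (hsr l).le (hP.1 k l))
    ⟨l, Finset.mem_univ l, mul_lt_mul_of_pos_left (hsr l) hl⟩

end Adjoint

/-! ### Discounted fixed points of monotone additively homogeneous maps. -/

theorem dist_le_of_monotone_of_add {n : ℕ} {f : (Fin n → ℝ) → (Fin n → ℝ)} (hf : Monotone f)
    (hadd : ∀ (c : ℝ) x j, f (fun l => c + x l) j = c + f x j) (x y : Fin n → ℝ) :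
    dist (f x) (f y) ≤ dist x y := by
  have key : ∀ x y : Fin n → ℝ, ∀ j, f x j ≤ dist x y + f y j := by
    intro x y j
    rw [← hadd]
    refine hf (fun l => ?_) j
    have h1 := dist_le_pi_dist x y l
    rw [Real.dist_eq] at h1
    have h2 := le_abs_self (x l - y l)
    linarith
  rw [dist_pi_le_iff dist_nonneg]
  intro j
  rw [Real.dist_eq, abs_le]
  have h1 := key x y j
  have h2 := key y x j
  rw [dist_comm] at h2
  constructor <;> linarith

/-- The discounted equation `v = f (α v)` has a solution. -/
theorem exists_discounted_fixedPoint {n : ℕ} {f : (Fin n → ℝ) → (Fin n → ℝ)} (hf : Monotone f)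
    (hadd : ∀ (c : ℝ) x j, f (fun l => c + x l) j = c + f x j) {α : ℝ} (h0 : 0 < α)
    (h1 : α < 1) : ∃ v, f (α • v) = v := by
  have hc : ContractingWith (⟨α, h0.le⟩ : NNReal) fun v => f (α • v) := by
    refine ⟨by exact_mod_cast h1, LipschitzWith.of_dist_le_mul fun x y => ?_⟩
    refine (dist_le_of_monotone_of_add hf hadd _ _).trans ?_
    rw [dist_smul₀, Real.norm_of_nonneg h0.le]
    rfl
  exact ⟨hc.fixedPoint, hc.fixedPoint_isFixedPt⟩

/-- If a monotone additively homogeneous map has no strict sub-fixed point, then it has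
approximate super-fixed points that are nonnegative and have a zero entry. -/
theorem exists_approx_superFixedPoint {n : ℕ} (hn : 1 ≤ n) {f : (Fin n → ℝ) → (Fin n → ℝ)}
    (hf : Monotone f) (hadd : ∀ (c : ℝ) x j, f (fun l => c + x l) j = c + f x j)
    (hns : ¬ ∃ x, ∀ j, x j < f x j) {α : ℝ} (h0 : 0 < α) (h1 : α < 1) :
    ∃ (x : Fin n → ℝ) (j₀ : Fin n), (∀ j, 0 ≤ x j) ∧ x j₀ = 0 ∧ ∀ j, f x j ≤ α⁻¹ * x j := by
  obtain ⟨v, hv⟩ := exists_discounted_fixedPoint hf hadd h0 h1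
  have : Nonempty (Fin n) := ⟨⟨0, hn⟩⟩
  obtain ⟨j₀, hj₀⟩ := Finite.exists_min v
  -- If every `v j` were positive, then `α v < v = f (α v)` would be a strict sub-fixed point.
  have ht : v j₀ ≤ 0 := by
    by_contra! ht
    refine hns ⟨α • v, fun j => ?_⟩
    rw [hv]
    have := hj₀ j
    simp only [Pi.smul_apply, smul_eq_mul]
    nlinarith
  -- Shift `α v` to have minimum zero; the final inequality reduces to `-α v j₀ ≤ -v j₀`, true since
  -- `v j₀ ≤ 0`.
  refine ⟨fun l => -(α * v j₀) + (α • v) l, j₀, fun j => ?_, ?_, fun j => ?_⟩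
  · have := mul_le_mul_of_nonneg_left (hj₀ j) h0.le
    simp only [Pi.smul_apply, smul_eq_mul]
    linarith
  · simp
  · rw [hadd, hv]
    simp only [Pi.smul_apply, smul_eq_mul]
    have : α⁻¹ * (-(α * v j₀) + α * v j) = - v j₀ + v j := by field_simp
    rw [this]
    nlinarith

/-! ### The alternative between `F` and `F*`. -/

section Duality

variable {m n q : ℕ} {A : Matrix (Fin m) (Fin n) MaxPlus} {B : Matrix (Fin m) (Fin q) MaxPlus}
  {P : Matrix (Fin q) (Fin n) ℝ}

theorem maxPlusMulVec_realVec_ne_bot (hB : RowFinite B) (x : Fin q → ℝ) (i : Fin m) :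
    maxPlusMulVec B (realVec x) i ≠ ⊥ := by
  obtain ⟨k, hk⟩ := hB i
  intro h
  have := le_maxPlusMulVec B (realVec x) i k
  rw [h, le_bot_iff, WithBot.add_eq_bot] at this
  rcases this with h | h
  · exact hk h
  · exact WithBot.coe_ne_bot h

theorem shapley_realVec_ne_bot (hB : RowFinite B) (hA : ColFinite A) (x : Fin n → ℝ) (j : Fin n) :
    shapley A B P (realVec x) j ≠ ⊥ := by
  intro h
  obtain ⟨i, -, hi⟩ := exists_le_add_adjointTrop hA
    (maxPlusMulVec B (stochMulVec P (realVec x))) j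
  change _ ≤ _ + shapley A B P (realVec x) j at hi
  rw [h, WithBot.add_bot, stochMulVec_realVec, le_bot_iff] at hi
  exact maxPlusMulVec_realVec_ne_bot hB _ i hi

theorem shapley_mono (hA : ColFinite A) (hP : IsRowStochastic P) : Monotone (shapley A B P) :=
  (adjointTrop_mono hA).comp ((maxPlusMulVec_mono B).comp (stochMulVec_mono hP))

theorem shapley_coe_add (hA : ColFinite A) (hP : IsRowStochastic P) (c : ℝ) (x : Fin n → ℝ)
    (j : Fin n) :
    shapley A B P (realVec fun l => c + x l) j = (c : MaxPlus) + shapley A B P (realVec x) j := by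
  have h1 : stochMulVec P (realVec fun l => c + x l)
      = fun k => (c : MaxPlus) + stochMulVec P (realVec x) k := by
    funext k
    rw [stochMulVec_realVec, stochMulVec_realVec]
    simp only [realVec, ← WithBot.coe_add, mul_add, Finset.sum_add_distrib, ← Finset.sum_mul,
      hP.2 k, one_mul]
  simp only [shapley, Function.comp_apply]
  rw [h1, ← adjointTrop_coe_add hA]
  congr 1
  funext i
  exact maxPlusMulVec_coe_add B c _ i

theorem le_dualShapley_iff (hB : RowFinite B) {y : Fin m → MaxPlus} :
    y ≤ dualShapley A B P y ↔
      ∀ i k, B i k + y i ≤ stochMulVec P (maxPlusMulVec Aᵀ y) k :=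
  forall_congr' fun _ => le_adjointTrop_iff (A := Bᵀ) hB

theorem not_feasible_dual_and_strictFeasible (hB : RowFinite B) (hA : ColFinite A)
    (hP : IsRowStochastic P) :
    ¬ (Feasible (dualShapley A B P) ∧ StrictFeasible (shapley A B P)) := by
  rintro ⟨⟨y, hy0, hy⟩, x, hx⟩
  rw [le_dualShapley_iff hB] at hy
  set b := maxPlusMulVec B (stochMulVec P (realVec x)) with hb
  have hbne : ∀ i, b i ≠ ⊥ := by
    intro i; rw [hb, stochMulVec_realVec]; exact maxPlusMulVec_realVec_ne_bot hB _ i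
  have hlt : ∀ i j, A i j + (x j : MaxPlus) < b i := by
    intro i j
    by_cases hAij : A i j = ⊥
    · rw [hAij, WithBot.bot_add]; exact bot_lt_iff_ne_bot.mpr (hbne i)
    · refine lt_of_lt_of_le ?_ ((le_adjointTrop_iff hA (y := b) (j := j)).mp le_rfl i)
      exact WithBot.add_lt_add_left hAij (hx j)
  obtain ⟨i₁, hi₁⟩ := Function.ne_iff.mp hy0
  have : Nonempty (Fin m) := ⟨i₁⟩
  -- With `t` this maximum, `Aᵀy < t - x`, hence `B i₀ k + y i₀ < t - (Px) k` for every `k`; a `k`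
  -- attaining `b i₀` gives equality instead.
  obtain ⟨i₀, hi₀⟩ := Finite.exists_max fun i => y i + b i
  have hne : y i₀ + b i₀ ≠ ⊥ := by
    intro h
    have := hi₀ i₁
    rw [h, le_bot_iff, WithBot.add_eq_bot] at this
    exact this.elim hi₁ (hbne i₁)
  obtain ⟨t, ht⟩ := WithBot.ne_bot_iff_exists.mp hne
  have hz : ∀ j, maxPlusMulVec Aᵀ y j < ((t - x j : ℝ) : MaxPlus) := by
    intro j
    refine (Finset.sup_lt_iff (WithBot.bot_lt_coe _)).mpr fun i _ => ?_
    by_cases hyi : y i = ⊥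
    · rw [hyi, WithBot.add_bot]; exact WithBot.bot_lt_coe _
    · have h1 : y i + (A i j + (x j : MaxPlus)) < (t : MaxPlus) := by
        rw [ht]; exact (WithBot.add_lt_add_left hyi (hlt i j)).trans_le (hi₀ i)
      rw [Matrix.transpose_apply]
      by_cases hAij : A i j = ⊥
      · rw [hAij, WithBot.bot_add]; exact WithBot.bot_lt_coe _
      obtain ⟨a, ha⟩ := WithBot.ne_bot_iff_exists.mp hAij
      obtain ⟨s, hs⟩ := WithBot.ne_bot_iff_exists.mp hyi
      rw [← ha, ← hs] at h1 ⊢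
      norm_cast at h1 ⊢
      linarith
  have : Nonempty (Fin q) := ⟨(hB i₀).choose⟩
  obtain ⟨k, -, hk⟩ := Finset.exists_mem_eq_sup Finset.univ Finset.univ_nonempty
    (fun k => B i₀ k + stochMulVec P (realVec x) k)
  have h2 : (t : MaxPlus) = (B i₀ k + y i₀) + stochMulVec P (realVec x) k := by
    rw [ht, hb]
    change y i₀ + Finset.univ.sup _ = _
    rw [hk, add_left_comm, add_assoc]
  have h3 := stochMulVec_lt hP hz k
  have h4 : ∑ l, P k l * (t - x l) = t - ∑ l, P k l * x l := by
    simp only [mul_sub, Finset.sum_sub_distrib, ← Finset.sum_mul, hP.2 k, one_mul]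
  rw [h4] at h3
  have h5 := (hy i₀ k).trans_lt h3
  rw [stochMulVec_realVec] at h2
  obtain ⟨d, hd⟩ : ∃ d : ℝ, (d : MaxPlus) = B i₀ k + y i₀ := by
    refine WithBot.ne_bot_iff_exists.mp fun h => ?_
    rw [h, WithBot.bot_add] at h2
    exact WithBot.coe_ne_bot h2
  rw [← hd] at h2 h5
  simp only [realVec] at h2
  norm_cast at h2 h5
  linarith

/-- A limit policy: a map `σ` of the columns of `A` to its rows, a nonempty set of columns and a
real vector on it that is a super-fixed point. -/
theorem feasible_dual_of_policy (hB : RowFinite B) (hP : IsRowStochastic P)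
    (σ : Fin n → Fin m) (a X : Fin n → ℝ) (ha : ∀ j, A (σ j) j = (a j : MaxPlus))
    (S : Set (Fin n)) {j₀ : Fin n} (hj₀ : j₀ ∈ S)
    (hS : ∀ j ∈ S, ∀ k (b : ℝ), B (σ j) k = (b : MaxPlus) →
      (∀ l, P k l ≠ 0 → l ∈ S) ∧ b + ∑ l, P k l * X l ≤ a j + X j) :
    Feasible (dualShapley A B P) := by
  classical
  -- Chosen so that `Aᵀw ≥ -X` on `S`, while each finite `w i` comes from a single `j ∈ S` with `σ j
  -- = i`, where the hypothesis applies.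
  let w : Fin m → MaxPlus := fun i => Finset.univ.sup fun j =>
    if σ j = i ∧ j ∈ S then ((-(a j + X j) : ℝ) : MaxPlus) else ⊥
  have hw : ∀ j ∈ S, ((-(a j + X j) : ℝ) : MaxPlus) ≤ w (σ j) := by
    intro j hj
    have := Finset.le_sup (f := fun j' => if σ j' = σ j ∧ j' ∈ S
      then ((-(a j' + X j') : ℝ) : MaxPlus) else ⊥) (Finset.mem_univ j)
    rwa [if_pos ⟨rfl, hj⟩] at this
  have hAw : ∀ j ∈ S, ((-X j : ℝ) : MaxPlus) ≤ maxPlusMulVec Aᵀ w j := by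
    intro j hj
    refine le_trans ?_ (le_maxPlusMulVec Aᵀ w j (σ j))
    rw [Matrix.transpose_apply, ha]
    refine le_trans ?_ (add_le_add_right (hw j hj) _)
    norm_cast
    linarith
  refine ⟨w, fun h => ?_, (le_dualShapley_iff hB).mpr fun i k => ?_⟩
  · have := hw j₀ hj₀
    rw [h] at this
    simp at this
  · have : Nonempty (Fin n) := ⟨j₀⟩
    obtain ⟨j, -, hj⟩ := Finset.exists_mem_eq_sup Finset.univ Finset.univ_nonempty
      (fun j => if σ j = i ∧ j ∈ S then ((-(a j + X j) : ℝ) : MaxPlus) else ⊥)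
    change w i = _ at hj
    rw [hj]
    split_ifs with hc
    · obtain ⟨rfl, hjS⟩ := hc
      by_cases hbot : B (σ j) k = ⊥
      · rw [hbot, WithBot.bot_add]; exact bot_le
      obtain ⟨b, hb⟩ := WithBot.ne_bot_iff_exists.mp hbot
      obtain ⟨h1, h2⟩ := hS j hjS k b hb.symm
      have h3 : ((∑ l, P k l * (-X l) : ℝ) : MaxPlus) ≤ stochMulVec P (maxPlusMulVec Aᵀ w) k := by
        rw [coe_finset_sum]
        refine Finset.sum_le_sum fun l _ => ?_
        -- Outside `S` the vector `Aᵀw` may be `⊥`, but the weight is zero there and `0 * ⊥ = 0`.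
        by_cases hl : P k l = 0
        · simp [hl]
        · rw [WithBot.coe_mul]
          exact coe_mul_le_coe_mul (hP.1 k l) (hAw l (h1 l hl))
      refine le_trans ?_ h3
      rw [← hb]
      norm_cast
      simp only [mul_neg, Finset.sum_neg_distrib]
      linarith
    · rw [WithBot.add_bot]; exact bot_le

theorem feasible_dual_of_not_strictFeasible (hn : 1 ≤ n) (hB : RowFinite B) (hA : ColFinite A)
    (hP : IsRowStochastic P) (hns : ¬ StrictFeasible (shapley A B P)) :
    Feasible (dualShapley A B P) := by
  choose f hf using fun x j =>
    WithBot.ne_bot_iff_exists.mp (shapley_realVec_ne_bot (P := P) hB hA x j)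
  have hmono : Monotone f := by
    intro x y h j
    have : realVec x ≤ realVec y := fun l => WithBot.coe_le_coe.mpr (h l)
    have := shapley_mono (B := B) hA hP this j
    rw [← hf, ← hf] at this
    exact WithBot.coe_le_coe.mp this
  have hadd : ∀ (c : ℝ) x j, f (fun l => c + x l) j = c + f x j := by
    intro c x j
    have := shapley_coe_add (B := B) hA hP c x j
    rw [← hf, ← hf] at this
    exact_mod_cast this
  have hns' : ¬ ∃ x, ∀ j, x j < f x j := by
    rintro ⟨x, hx⟩
    refine hns ⟨x, fun j => ?_⟩
    rw [← hf]
    exact_mod_cast hx j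
  -- The discount factor is `1 - 1/(N+2)`, in `(0, 1)` even for `N = 0`. The pair `p` (zero
  -- coordinate, policy) lives in a finite type.
  have step : ∀ N : ℕ, ∃ (x : Fin n → ℝ) (p : Fin n × (Fin n → Fin m)),
      (∀ j, 0 ≤ x j) ∧ x p.1 = 0 ∧ ∀ j, A (p.2 j) j ≠ ⊥ ∧ ∀ k,
        B (p.2 j) k + ((∑ l, P k l * x l : ℝ) : MaxPlus) ≤
          A (p.2 j) j + (((1 - 1 / ((N : ℝ) + 2))⁻¹ * x j : ℝ) : MaxPlus) := by
    intro N
    have hN : (0 : ℝ) < 1 / ((N : ℝ) + 2) := by positivity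
    have hN' : 1 / ((N : ℝ) + 2) < 1 := by
      rw [div_lt_one (by positivity)]
      have : (0 : ℝ) ≤ N := by positivity
      linarith
    obtain ⟨x, j₀, hx, hx0, hfx⟩ := exists_approx_superFixedPoint hn hmono hadd hns'
      (α := 1 - 1 / ((N : ℝ) + 2)) (by linarith) (by linarith)
    choose σ hσ hσ' using exists_le_add_adjointTrop hA
      (maxPlusMulVec B (stochMulVec P (realVec x)))
    refine ⟨x, (j₀, σ), hx, hx0, fun j => ⟨hσ j, fun k => ?_⟩⟩
    have h1 := le_maxPlusMulVec B (stochMulVec P (realVec x)) (σ j) k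
    have h2 := h1.trans (hσ' j)
    rw [stochMulVec_realVec] at h2
    refine h2.trans (add_le_add_right ?_ _)
    have h3 : (f x j : MaxPlus) ≤ (((1 - 1 / ((N : ℝ) + 2))⁻¹ * x j : ℝ) : MaxPlus) :=
      WithBot.coe_le_coe.mpr (hfx j)
    rw [hf] at h3
    rwa [shapley, Function.comp_apply, Function.comp_apply, stochMulVec_realVec] at h3
  choose x p hx hx0 hstep using step
  -- Along an ultrafilter `p` is eventually constant and every coordinate converges in the compact
  -- space `EReal`, so no subsequences are extracted.
  let U : Ultrafilter ℕ := hyperfilter ℕ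
  obtain ⟨⟨j₀, σ⟩, hpure⟩ := Ultrafilter.eq_pure_of_finite (U.map p)
  have hp : ∀ᶠ N in (U : Filter ℕ), p N = (j₀, σ) := by
    have : {(j₀, σ)} ∈ U.map p := by rw [hpure]; exact Ultrafilter.mem_pure.mpr rfl
    exact this
  have hlim : ∀ j, ∃ Y : EReal, Tendsto (fun N => (x N j : EReal)) U (𝓝 Y) := fun j =>
    ⟨_, (U.map fun N => (x N j : EReal)).le_nhds_lim⟩
  choose Y hY using hlim
  have hY0 : ∀ j, 0 ≤ Y j := fun j =>
    ge_of_tendsto' (hY j) fun N => by exact_mod_cast hx N j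
  have hYr : ∀ j, Y j ≠ ⊤ → Tendsto (fun N => x N j) U (𝓝 (Y j).toReal) := fun j hj =>
    (EReal.tendsto_toReal hj ((EReal.bot_lt_zero.trans_le (hY0 j)).ne')).comp (hY j)
  have hα : Tendsto (fun N : ℕ => (1 - 1 / ((N : ℝ) + 2))⁻¹) U (𝓝 1) := by
    have h : Tendsto (fun N : ℕ => (1 - 1 / ((N : ℝ) + 2))⁻¹) atTop (𝓝 1) := by
      have h1 : Tendsto (fun N : ℕ => ((N : ℝ) + 2)) atTop atTop :=
        tendsto_atTop_add_const_right _ _ tendsto_natCast_atTop_atTop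
      have h2 := (tendsto_const_nhds (x := (1 : ℝ))).sub
        ((tendsto_const_nhds (x := (1 : ℝ))).div_atTop h1)
      simpa using h2.inv₀ (by simp)
    exact h.mono_left Nat.hyperfilter_le_atTop
  have hAσ : ∀ j, A (σ j) j ≠ ⊥ := by
    obtain ⟨N, hN⟩ := hp.exists
    intro j
    have := (hstep N j).1
    rwa [hN] at this
  choose a ha using fun j => WithBot.ne_bot_iff_exists.mp (hAσ j)
  refine feasible_dual_of_policy hB hP σ a (fun j => (Y j).toReal) (fun j => (ha j).symm)
    {j | Y j ≠ ⊤} (j₀ := j₀) ?_ ?_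
  · have h0 : Tendsto (fun N => (x N j₀ : EReal)) U (𝓝 0) := by
      refine tendsto_const_nhds.congr' ?_
      filter_upwards [hp] with N hN
      have := hx0 N
      rw [hN] at this
      simp only at this
      rw [this]; rfl
    rw [Set.mem_ofPred_eq, tendsto_nhds_unique (hY j₀) h0]
    exact EReal.zero_ne_top
  · intro j hj k b hb
    have hineq : ∀ᶠ N in (U : Filter ℕ),
        b + ∑ l, P k l * x N l ≤ a j + (1 - 1 / ((N : ℝ) + 2))⁻¹ * x N j := by
      filter_upwards [hp] with N hN
      have := (hstep N j).2 k
      rw [hN] at this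
      simp only [hb, ← ha] at this
      exact_mod_cast this
    have hR : Tendsto (fun N : ℕ => a j + (1 - 1 / ((N : ℝ) + 2))⁻¹ * x N j) U
        (𝓝 (a j + (Y j).toReal)) := by
      simpa using tendsto_const_nhds.add (hα.mul (hYr j hj))
    have hfin : ∀ l, P k l ≠ 0 → Y l ≠ ⊤ := by
      intro l hl
      have hl' : 0 < P k l := lt_of_le_of_ne (hP.1 k l) (Ne.symm hl)
      -- As `x ≥ 0`, the term at `l` is at most the whole sum, which is bounded by a convergent
      -- right-hand side; the `+ 1` is slack for an eventual bound.
      have hle : Y l ≤ (((a j + (Y j).toReal + 1 - b) / P k l : ℝ) : EReal) := by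
        refine le_of_tendsto (hY l) ?_
        filter_upwards [hineq, hR.eventually_lt_const (lt_add_one _)] with N h1 h2
        refine EReal.coe_le_coe_iff.mpr ?_
        rw [le_div_iff₀ hl']
        have h3 : P k l * x N l ≤ ∑ l, P k l * x N l :=
          Finset.single_le_sum (f := fun l => P k l * x N l)
            (fun l _ => mul_nonneg (hP.1 k l) (hx N l)) (Finset.mem_univ l)
        linarith
      exact (hle.trans_lt (EReal.coe_lt_top _)).ne
    refine ⟨hfin, le_of_tendsto_of_tendsto ?_ hR hineq⟩
    refine tendsto_const_nhds.add (tendsto_finsetSum _ fun l _ => ?_)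
    by_cases hl : P k l = 0
    · simp [hl]
    · exact (hYr l (hfin l hl)).const_mul _

theorem strictFeasible_iff_not_feasible_dual (hn : 1 ≤ n) (hB : RowFinite B) (hA : ColFinite A)
    (hP : IsRowStochastic P) :
    StrictFeasible (shapley A B P) ↔ ¬ Feasible (dualShapley A B P) :=
  ⟨fun h h' => not_feasible_dual_and_strictFeasible hB hA hP ⟨h', h⟩, fun h => by
    by_contra h'
    exact h (feasible_dual_of_not_strictFeasible hn hB hA hP h')⟩

/-! ### Perturbations and condition numbers. -/

theorem Feasible.mono {F G : (Fin n → MaxPlus) → (Fin n → MaxPlus)} (h : ∀ x, F x ≤ G x) :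
    Feasible F → Feasible G :=
  fun ⟨x, hx0, hx⟩ => ⟨x, hx0, hx.trans (h x)⟩

theorem StrictFeasible.mono {F G : (Fin n → MaxPlus) → (Fin n → MaxPlus)}
    (h : ∀ x, F x ≤ G x) : StrictFeasible F → StrictFeasible G :=
  fun ⟨x, hx⟩ => ⟨x, fun i => (hx i).trans_le (h _ i)⟩

theorem StrictFeasible.feasible (hn : 1 ≤ n) {F : (Fin n → MaxPlus) → (Fin n → MaxPlus)} :
    StrictFeasible F → Feasible F := fun ⟨x, hx⟩ =>
  ⟨realVec x, fun h => WithBot.coe_ne_bot (congrFun h ⟨0, hn⟩), fun i => (hx i).le⟩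

theorem perturb_mono {u v : Fin n → ℝ} (h : u ≤ v) (F : (Fin n → MaxPlus) → (Fin n → MaxPlus))
    (x : Fin n → MaxPlus) : perturb u F x ≤ perturb v F x := by
  intro i
  have : (u i : MaxPlus) ≤ (v i : MaxPlus) := WithBot.coe_le_coe.mpr (h i)
  exact add_le_add_left this _

theorem le_const_norm (u : Fin n → ℝ) : u ≤ fun _ => ‖u‖ :=
  fun i => (le_abs_self _).trans (norm_le_pi_norm u i)

theorem const_neg_norm_le (u : Fin n → ℝ) : (fun _ => -‖u‖) ≤ u :=
  fun i => (neg_le_neg (norm_le_pi_norm u i)).trans (neg_abs_le _)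

/-- Perturbing `F` by a constant is dual to perturbing `F*` by the opposite constant. -/
theorem strictFeasible_perturb_iff (hn : 1 ≤ n) (hB : RowFinite B) (hA : ColFinite A)
    (hP : IsRowStochastic P) (c : ℝ) :
    StrictFeasible (perturb (fun _ => c) (shapley A B P)) ↔
      ¬ Feasible (perturb (fun _ => -c) (dualShapley A B P)) := by
  -- The constant is absorbed into `B`, which enters `F` directly but `F*` through its adjoint,
  -- hence the opposite signs.
  let B' : Matrix (Fin m) (Fin q) MaxPlus := Matrix.of fun i k => (c : MaxPlus) + B i k
  have hB' : RowFinite B' := by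
    intro i
    obtain ⟨k, hk⟩ := hB i
    refine ⟨k, fun h => ?_⟩
    rcases WithBot.add_eq_bot.mp (show (c : MaxPlus) + B i k = ⊥ from h) with h | h
    · exact WithBot.coe_ne_bot h
    · exact hk h
  have h1 : perturb (fun _ => c) (shapley A B P) = shapley A B' P := by
    funext x j
    simp only [perturb, shapley, Function.comp_apply, Pi.add_apply, realVec]
    rw [← adjointTrop_coe_add hA]
    congr 1
    funext i
    exact (maxPlusMulVec_shift c (fun _ _ => rfl) _ i).symm
  have h2 : perturb (fun _ => -c) (dualShapley A B P) = dualShapley A B' P := by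
    funext y i
    simp only [perturb, dualShapley, Function.comp_apply, Pi.add_apply, realVec]
    refine (adjointTrop_shift (A := Bᵀ) (A' := B'ᵀ) hB hB' (-c) (fun k i => ?_) _ i).symm
    rw [neg_neg]; rfl
  rw [h1, h2]
  exact strictFeasible_iff_not_feasible_dual hn hB' hA hP

/-- Compares distances to infeasibility or feasibility in spaces of different dimensions, via
constant vectors of the same sup-norm. -/
theorem iInf_norm_le {k l : ℕ} (hl : 1 ≤ l) {Q : (Fin k → ℝ) → Prop} {R : (Fin l → ℝ) → Prop}
    (h : ∀ u, Q u → R (fun _ => ‖u‖) ∨ R (fun _ => -‖u‖)) :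
    (⨅ (u : Fin l → ℝ) (_ : R u), ENNReal.ofReal ‖u‖) ≤
      ⨅ (u : Fin k → ℝ) (_ : Q u), ENNReal.ofReal ‖u‖ := by
  have : Nonempty (Fin l) := ⟨⟨0, hl⟩⟩
  refine le_iInf₂ fun u hu => ?_
  rcases h u hu with h | h
  · refine (iInf₂_le _ h).trans ?_
    rw [pi_norm_const, norm_norm]
  · refine (iInf₂_le _ h).trans ?_
    rw [pi_norm_const, norm_neg, norm_norm]

theorem condReal_shapley_eq_cond_dualShapley (hm : 1 ≤ m) (hn : 1 ≤ n) (hB : RowFinite B)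
    (hA : ColFinite A) (hP : IsRowStochastic P) :
    condReal (shapley A B P) = cond (dualShapley A B P) := by
  have hdual := strictFeasible_iff_not_feasible_dual hn hB hA hP
  have hshift := strictFeasible_perturb_iff hn hB hA hP
  have hSF : ∀ {u v : Fin n → ℝ}, u ≤ v → StrictFeasible (perturb u (shapley A B P)) →
      StrictFeasible (perturb v (shapley A B P)) :=
    fun h => StrictFeasible.mono (perturb_mono h _)
  have hF : ∀ {u v : Fin m → ℝ}, u ≤ v → Feasible (perturb u (dualShapley A B P)) →
      Feasible (perturb v (dualShapley A B P)) :=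
    fun h => Feasible.mono (perturb_mono h _)
  unfold condReal cond condNumber
  by_cases hs : StrictFeasible (shapley A B P)
  · rw [if_pos hs, if_neg (hdual.mp hs)]
    congr 1
    -- Destroying strict feasibility of `F` is easiest with `-‖u‖`, creating feasibility of `F*`
    -- with `+‖u‖`; the shift duality exchanges the two.
    refine le_antisymm (iInf_norm_le hn fun u hu => Or.inr fun h => ?_)
      (iInf_norm_le hm fun u hu => Or.inl ?_)
    · rw [hshift, neg_neg] at h
      exact h (hF (le_const_norm u) hu)
    · by_contra h
      rw [← neg_neg ‖u‖, ← hshift] at h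
      exact hu (hSF (const_neg_norm_le u) h)
  · rw [if_neg hs, if_pos (not_not.mp (mt hdual.mpr hs))]
    congr 1
    refine le_antisymm (iInf_norm_le hn fun u hu => Or.inl ?_)
      (iInf_norm_le hm fun u hu => Or.inr ?_)
    · rw [hshift]
      exact fun h => hu (hF (const_neg_norm_le u) h)
    · rw [← hshift]
      exact hSF (le_const_norm u) hu

end Duality

end MeanPayoff

theorem mainTheorem4 (m n q : ℕ) (hm : 1 ≤ m) (hn : 1 ≤ n) (hq : 1 ≤ q)
    (A : Matrix (Fin m) (Fin n) MeanPayoff.MaxPlus)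
    (B : Matrix (Fin m) (Fin q) MeanPayoff.MaxPlus)
    (P : Matrix (Fin q) (Fin n) ℝ)
    (hBrow : MeanPayoff.RowFinite B)
    (hAcol : MeanPayoff.ColFinite A)
    (hArow : MeanPayoff.RowFinite A)
    (hP : MeanPayoff.IsRowStochastic P) :
    MeanPayoff.condReal (MeanPayoff.shapley A B P)
        = MeanPayoff.cond (MeanPayoff.dualShapley A B P) ∧
    ((MeanPayoff.Feasible (MeanPayoff.dualShapley A B P) ∨
        MeanPayoff.StrictFeasible (MeanPayoff.shapley A B P)) ∧
      ¬ (MeanPayoff.Feasible (MeanPayoff.dualShapley A B P) ∧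
        MeanPayoff.StrictFeasible (MeanPayoff.shapley A B P))) ∧
    ¬ (MeanPayoff.StrictFeasible (MeanPayoff.shapley A B P) ∧
        MeanPayoff.StrictFeasible (MeanPayoff.dualShapley A B P)) := by
  have h := MeanPayoff.strictFeasible_iff_not_feasible_dual hn hBrow hAcol hP
  refine ⟨MeanPayoff.condReal_shapley_eq_cond_dualShapley hm hn hBrow hAcol hP,
    ⟨?_, fun ⟨h1, h2⟩ => h.mp h2 h1⟩, fun ⟨h1, h2⟩ => h.mp h1 (h2.feasible hm)⟩
  by_cases h' : MeanPayoff.Feasible (MeanPayoff.dualShapley A B P)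
  · exact Or.inl h'
  · exact Or.inr (h.mpr h')
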